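/- Let $A$ be a finite alphabet and let $\mathbf z = z_0z_1z_2\cdots \in A^{\mathbb N}$ be an infinite word. Let $\mathrm{Fac}_n(\mathbf z)$ be the set of factors (blocks of consecutive letters) of $\mathbf z$ of length $n$; the word $\mathbf z$ is called Sturmian if $\#\mathrm{Fac}_n(\mathbf z) = n+1$ for all $n \ge 0$. For finite words $u = u_1\cdots u_m$ and $x$ over $A$, let $\binom{u}{x}$ be the number of sets of positions $i_1 < \cdots < i_{|x|}$ such that $u_{i_1}\cdots u_{i_{|x|}} = x$; write $u \sim_k v$ if $\binom{u}{x} = \binom{v}{x}$ for all words $x$ over $A$ of length at most $k$, and let $\mathrm b^{(k)}_{\mathbf z}(n) = \#\bigl(\mathrm{Fac}_n(\mathbf z)/{\sim_k}\bigr)$ be the $k$-binomial complexity of $\mathbf z$. Theorem. Let $k \ge 2$ be an integer. If $\mathrm b^{(k)}_{\mathbf z}(n) = n+1$ for all $n \ge 0$, then $\mathbf z$ is Sturmian. Conversely, if $\mathbf z$ is Sturmian, then $\mathrm b^{(k)}_{\mathbf z}(n) = n+1$ for all $n \ge 0$. Thus, for each single $k \ge 2$, Sturmian words are characterized by their $k$-binomial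 complexity. -/

import Mathlib

namespace InfWord

/-- The binomial coefficient of the finite words `u` and `w`: the number of times `w` occurs in `u`
as a (scattered) subword. The list `u.sublists'` has exactly one entry for each set of positions
`i₁ < i₂ < ⋯` of `u`, namely the subword read at these positions, so that counting the entries
equal to `w` counts the occurrences of `w` with multiplicity. -/
def binom {A : Type*} [DecidableEq A] (u w : List A) : ℕ :=
  u.sublists'.count w

/-- `u` and `v` are `k`-binomially equivalent: every word `x` of length at most `k` (over the
alphabet `A`) occurs as a subword equally often in `u` and in `v`. -/
def binomEquiv (A : Type*) [DecidableEq A] (k : ℕ) : Setoid (List A) where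
  r u v := ∀ x : List A, x.length ≤ k → binom u x = binom v x
  iseqv :=
    { refl := fun _ _ _ => rfl
      symm := fun h x hx => (h x hx).symm
      trans := fun h₁ h₂ x hx => (h₁ x hx).trans (h₂ x hx) }

/-- The factor `z i, z (i + 1), …, z (i + n - 1)` of length `n` of the infinite word `z`. -/
def window {A : Type*} (z : ℕ → A) (i n : ℕ) : List A :=
  List.ofFn fun j : Fin n => z (i + j)

/-- The set of factors of length `n` of the infinite word `z`. -/
def factors {A : Type*} (z : ℕ → A) (n : ℕ) : Set (List A) :=
  Set.range fun i => window z i n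

/-- The factor complexity of `z`: the number of factors of length `n`. -/
noncomputable def factorComplexity {A : Type*} (z : ℕ → A) (n : ℕ) : ℕ :=
  Nat.card (factors z n)

/-- The `k`-binomial complexity of `z`: the number of classes of factors of length `n` modulo
`k`-binomial equivalence. -/
noncomputable def binomComplexity {A : Type*} [DecidableEq A] (k : ℕ) (z : ℕ → A) (n : ℕ) : ℕ :=
  Nat.card (Quotient ((binomEquiv A k).comap (Subtype.val : factors z n → List A)))

/-- An infinite word is Sturmian if it has exactly `n + 1` factors of length `n`, for all `n`. -/
def IsSturmian {A : Type*} (z : ℕ → A) : Prop :=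
  ∀ n : ℕ, factorComplexity z n = n + 1

end InfWord

/-!
The numbers of `[a, c]` in `u`, summed over all letters `c`, count the pairs of an `a` and a later
position, so 2-binomial equivalence fixes the sum over all proper prefixes of `u` of their number
of `a`s. For two factors of the same length in a balanced binary word, the difference between the
numbers of `a`s in their prefixes of length `l` varies by at most one, so it has constant sign as
`l` varies; if it sums to zero, it vanishes, and the factors are equal.

For balance, follow Coven and Hedlund: a shortest unbalanced pair has the form `a s a`, `b s b` with
a palindrome `s`. When the complexity is `n + 1` at small lengths, each of these lengths has exactly
one right special factor, so `s` is right special and exactly one of `a s`, `b s` is, say `b s`.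
This one does not occur inside `a s a`, a stretch long enough to repeat a factor; from there on
every letter is forced and the word is eventually periodic, so its complexity is bounded.

Balance at lengths below `n` only involves the complexity below `n` and the absence of eventual
periodicity. The latter also follows from `k`-binomial complexity `n + 1`, since this is a lower
bound for the complexity; so the converse is an induction on `n`.
-/

namespace InfWord

variable {A : Type*}

section Binom

variable [DecidableEq A] {u v : List A} {k : ℕ}

lemma binom_nil_right (u : List A) : binom u [] = 1 := by
  induction u with
  | nil => simp [binom]
  | cons c u ih =>
    have hmap : (u.sublists'.map (List.cons c)).count [] = 0 := by simp [List.count_eq_zero]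
    rwa [binom, List.sublists'_cons, List.count_append, hmap]

lemma binom_cons_cons (c d : A) (u w : List A) :
    binom (c :: u) (d :: w) = binom u (d :: w) + if c = d then binom u w else 0 := by
  simp only [binom, List.sublists'_cons, List.count_append, Nat.add_left_cancel_iff]
  split_ifs with h
  · subst h
    exact List.count_map_of_injective _ _ List.cons_injective _
  · simp [List.count_eq_zero, h]

lemma binom_singleton (u : List A) (a : A) : binom u [a] = u.count a := by
  induction u with
  | nil => simp [binom]
  | cons c u ih => simp [binom_cons_cons, binom_nil_right, ih, List.count_cons]

lemma perm_of_binomEquiv (hk : 1 ≤ k) (h : binomEquiv A k u v) : u.Perm v :=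
  List.perm_iff_count.2 fun a => by simpa only [binom_singleton] using h [a] hk

lemma sum_binom_pair {S : Finset A} (hu : ∀ c ∈ u, c ∈ S) (a : A) :
    ∑ c ∈ S, binom u [a, c] = ∑ l ∈ Finset.range u.length, (u.take l).count a := by
  induction u with
  | nil => simp [binom]
  | cons d u ih =>
    have hlen : ∑ c ∈ S, u.count c = u.length := by
      simpa using Multiset.sum_count_eq_card (s := S) (m := u) fun c hc =>
        hu c (List.mem_cons_of_mem d hc)
    rw [List.length_cons, Finset.sum_range_succ']
    simp only [binom_cons_cons, binom_singleton, List.take_succ_cons, List.count_cons, beq_iff_eq,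
      List.take_zero, List.count_nil, add_zero, Finset.sum_add_distrib,
      ih fun c hc => hu c (List.mem_cons_of_mem d hc)]
    split_ifs <;> simp [hlen]

lemma sum_count_take_eq_of_binomEquiv (hk : 2 ≤ k) (h : binomEquiv A k u v) (a : A) :
    ∑ l ∈ Finset.range u.length, (u.take l).count a =
      ∑ l ∈ Finset.range v.length, (v.take l).count a := by
  have hperm : u.Perm v := perm_of_binomEquiv (by omega) h
  rw [← sum_binom_pair (S := u.toFinset) (by simp), ← sum_binom_pair (S := u.toFinset)
    fun c hc => by simpa using hperm.mem_iff.2 hc]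
  exact Finset.sum_congr rfl fun c _ => h [a, c] hk

end Binom

section Factor

variable {z : ℕ → A} {u v : List A} {n : ℕ}

lemma length_window (z : ℕ → A) (i n : ℕ) : (window z i n).length = n := by
  simp [window]

lemma window_add (z : ℕ → A) (i m n : ℕ) :
    window z i (m + n) = window z i m ++ window z (i + m) n := by
  simp [window, List.ofFn_add, Nat.add_assoc]

lemma window_succ (z : ℕ → A) (i n : ℕ) : window z i (n + 1) = window z i n ++ [z (i + n)] := by
  rw [window_add]
  simp [window]

lemma window_succ' (z : ℕ → A) (i n : ℕ) : window z i (n + 1) = z i :: window z (i + 1) n := by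
  rw [Nat.add_comm, window_add]
  simp [window]

/-- `u` is a factor of `z`, of unspecified length: the union of the sets `factors z n`. -/
def IsFactor (z : ℕ → A) (u : List A) : Prop :=
  ∃ i, window z i u.length = u

lemma isFactor_window (z : ℕ → A) (i n : ℕ) : IsFactor z (window z i n) :=
  ⟨i, by rw [length_window]⟩

lemma mem_factors_iff : u ∈ factors z n ↔ IsFactor z u ∧ u.length = n := by
  constructor
  · rintro ⟨i, rfl⟩
    exact ⟨isFactor_window z i n, length_window z i n⟩
  · rintro ⟨hu, rfl⟩
    exact hu

lemma IsFactor.of_infix (hv : IsFactor z v) (h : u <:+: v) : IsFactor z u := by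
  obtain ⟨i, hi⟩ := hv
  obtain ⟨p, q, rfl⟩ := h
  rw [List.length_append, List.length_append, window_add, window_add] at hi
  have hpu := (List.append_inj hi (by simp [length_window])).1
  exact ⟨i + p.length, (List.append_inj hpu (length_window _ _ _)).2⟩

lemma IsFactor.mem_range (hu : IsFactor z u) {c : A} (hc : c ∈ u) : c ∈ Set.range z := by
  obtain ⟨i, hi⟩ := hu
  rw [← hi, window, List.mem_ofFn] at hc
  obtain ⟨j, rfl⟩ := hc
  exact Set.mem_range_self _

lemma finite_factors (hz : (Set.range z).Finite) (n : ℕ) : (factors z n).Finite := by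
  refine ((Set.Finite.pi' fun _ : Fin n => hz).image List.ofFn).subset ?_
  rintro _ ⟨i, rfl⟩
  exact ⟨_, fun j => Set.mem_range_self _, rfl⟩

lemma exists_range_subset_pair (h : factorComplexity z 1 = 2) :
    ∃ a b, a ≠ b ∧ Set.range z ⊆ {a, b} := by
  obtain ⟨u, v, huv, he⟩ := Set.ncard_eq_two.1 h
  obtain ⟨x, rfl⟩ : u ∈ factors z 1 := by simp [he]
  obtain ⟨y, rfl⟩ : v ∈ factors z 1 := by simp [he]
  refine ⟨z x, z y, fun e => huv (by simp [window, e]), ?_⟩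
  rintro _ ⟨i, rfl⟩
  have hi : window z i 1 ∈ factors z 1 := Set.mem_range_self i
  simpa [he, window] using hi

end Factor

section RightSpecial

variable {z : ℕ → A} {u v : List A} {n x y : ℕ}

/-- `u` is a right special factor of `z`: it is followed by at least two distinct letters in `z`. -/
def IsRightSpecial (z : ℕ → A) (u : List A) : Prop :=
  ∃ c d, c ≠ d ∧ IsFactor z (u ++ [c]) ∧ IsFactor z (u ++ [d])

lemma IsRightSpecial.isFactor (hu : IsRightSpecial z u) : IsFactor z u := by
  obtain ⟨c, _, _, hc, _⟩ := hu
  exact hc.of_infix (List.prefix_append u [c]).isInfix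

lemma IsRightSpecial.of_suffix (hv : IsRightSpecial z v) (h : u <:+ v) : IsRightSpecial z u := by
  obtain ⟨c, d, hcd, hc, hd⟩ := hv
  obtain ⟨p, rfl⟩ := h
  exact ⟨c, d, hcd, hc.of_infix ⟨p, [], by simp⟩, hd.of_infix ⟨p, [], by simp⟩⟩

lemma isRightSpecial_window (h : window z x n = window z y n) (hne : z (x + n) ≠ z (y + n)) :
    IsRightSpecial z (window z x n) :=
  ⟨z (x + n), z (y + n), hne, window_succ z x n ▸ isFactor_window z x (n + 1),
    h ▸ window_succ z y n ▸ isFactor_window z y (n + 1)⟩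

lemma eq_of_not_isRightSpecial (hx : ¬ IsRightSpecial z (window z x n))
    (h : window z x n = window z y n) : z (x + n) = z (y + n) :=
  not_not.1 fun hne => hx (isRightSpecial_window h hne)

lemma window_add_one_eq_of_not_isRightSpecial (hx : ¬ IsRightSpecial z (window z x n))
    (h : window z x n = window z y n) : window z (x + 1) n = window z (y + 1) n := by
  have hsucc : window z x (n + 1) = window z y (n + 1) := by
    rw [window_succ, window_succ, h, eq_of_not_isRightSpecial hx h]
  rw [window_succ', window_succ'] at hsucc
  exact (List.cons.inj hsucc).2

lemma exists_isRightSpecial (hz : (Set.range z).Finite)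
    (h : factorComplexity z n < factorComplexity z (n + 1)) :
    ∃ u, IsRightSpecial z u ∧ u.length = n := by
  by_contra! hns
  refine h.not_ge (Set.ncard_le_ncard_of_injOn List.dropLast ?_ ?_ (finite_factors hz n))
  · rintro _ ⟨x, rfl⟩
    exact ⟨x, by simp [window_succ]⟩
  · rintro _ ⟨x, rfl⟩ _ ⟨y, rfl⟩ hxy
    simp only [window_succ, List.dropLast_concat] at hxy ⊢
    rw [hxy, eq_of_not_isRightSpecial (fun hx => hns _ hx (length_window z x n)) hxy]

lemma IsRightSpecial.eq_of_length_eq (hz : (Set.range z).Finite)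
    (hn : factorComplexity z (n + 1) ≤ factorComplexity z n + 1)
    (hu : IsRightSpecial z u) (hv : IsRightSpecial z v) (hun : u.length = n) (hvn : v.length = n) :
    u = v := by
  obtain ⟨c, d, hcd, huc, hud⟩ := hu
  obtain ⟨c', d', hcd', hvc, hvd⟩ := hv
  by_contra huv
  have hmem : {u ++ [c], v ++ [c']} ⊆ factors z (n + 1) := by
    simp [Set.insert_subset_iff, mem_factors_iff, huc, hvc, hun, hvn]
  have hsub : factors z n ⊆ List.dropLast '' (factors z (n + 1) \ {u ++ [c], v ++ [c']}) := by
    rintro _ ⟨x, rfl⟩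
    rcases eq_or_ne (window z x n) u with rfl | hxu
    · exact ⟨window z x n ++ [d], by simp [mem_factors_iff, hud, hun, huv, hcd.symm], by simp⟩
    rcases eq_or_ne (window z x n) v with rfl | hxv
    · exact ⟨window z x n ++ [d'], by simp [mem_factors_iff, hvd, hvn, hxu, hcd'.symm], by simp⟩
    · refine ⟨window z x (n + 1), ⟨⟨x, rfl⟩, ?_⟩, ?_⟩ <;> simp [window_succ, hxu, hxv]
  have hfin := finite_factors hz (n + 1)
  have hle : factorComplexity z n ≤ (factors z (n + 1) \ {u ++ [c], v ++ [c']}).ncard :=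
    (Set.ncard_le_ncard hsub (hfin.sdiff.image _)).trans (Set.ncard_image_le hfin.sdiff)
  have hadd := Set.ncard_sdiff_add_ncard_of_subset hmem hfin
  rw [Set.ncard_pair (by simp [huv])] at hadd
  change _ = factorComplexity z (n + 1) at hadd
  omega

end RightSpecial

section EventuallyPeriodic

variable {z : ℕ → A} {x p n : ℕ}

/-- `z` has period `p` from some position `N` on, for some `p > 0`. -/
def IsEventuallyPeriodic (z : ℕ → A) : Prop :=
  ∃ N p, 0 < p ∧ Function.Periodic (fun t => z (N + t)) p

lemma factorComplexity_le_of_periodic {N : ℕ} (hp : 0 < p)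
    (h : Function.Periodic (fun t => z (N + t)) p) (n : ℕ) : factorComplexity z n ≤ N + p := by
  have hsub : factors z n ⊆ (window z · n) '' (Finset.range (N + p) : Set ℕ) := by
    rintro _ ⟨x, rfl⟩
    rcases lt_or_ge x (N + p) with hx | hx
    · exact ⟨x, by simpa using hx, rfl⟩
    obtain ⟨t, rfl⟩ := Nat.exists_eq_add_of_le (le_of_add_le_left hx)
    refine ⟨N + t % p, by simpa using Nat.mod_lt t hp, ?_⟩
    refine congrArg List.ofFn (funext fun j => ?_)
    have hj := h.map_mod_nat (t + j)
    rw [← Nat.mod_add_mod, h.map_mod_nat] at hj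
    simpa only [Nat.add_assoc] using hj
  calc factorComplexity z n ≤ ((window z · n) '' (Finset.range (N + p) : Set ℕ)).ncard :=
        Set.ncard_le_ncard hsub (Set.toFinite _)
    _ ≤ (Finset.range (N + p) : Set ℕ).ncard := Set.ncard_image_le (Set.toFinite _)
    _ = N + p := by rw [Set.ncard_coe_finset, Finset.card_range]

lemma not_isEventuallyPeriodic_of_lt_factorComplexity (h : ∀ n, n < factorComplexity z n) :
    ¬ IsEventuallyPeriodic z := fun ⟨N, p, hp, hper⟩ =>
  (h (N + p)).not_ge (factorComplexity_le_of_periodic hp hper (N + p))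

lemma isEventuallyPeriodic_of_window_eq (hp : 0 < p) (h : window z (x + p) n = window z x n)
    (hns : ∀ t < p, ¬ IsRightSpecial z (window z (x + t) n)) : IsEventuallyPeriodic z := by
  have hmod : ∀ r, window z (x + r % p) n = window z (x + r) n := by
    intro r
    induction r with
    | zero => rw [Nat.zero_mod]
    | succ r ih =>
      have hr : r % p < p := Nat.mod_lt r hp
      have hstep := window_add_one_eq_of_not_isRightSpecial (hns _ hr) ih
      rcases (Nat.add_one_le_iff.2 hr).lt_or_eq with hlt | heq
      · rwa [← Nat.mod_add_mod, Nat.mod_eq_of_lt hlt]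
      · rw [← Nat.mod_add_mod, heq, Nat.mod_self]
        rwa [Nat.add_assoc, heq, h] at hstep
  refine ⟨x + n, p, hp, fun r => ?_⟩
  have hnext : ∀ r, z (x + r % p + n) = z (x + r + n) := fun r =>
    eq_of_not_isRightSpecial (hns _ (Nat.mod_lt r hp)) (hmod r)
  have hr := hnext (r + p)
  rw [Nat.add_mod_right, hnext r] at hr
  simpa only [Nat.add_right_comm] using hr.symm

/-- The stretch may be one position short of a plain pigeonhole, as `w` is a factor it misses. -/
lemma isEventuallyPeriodic_of_forall_not_isRightSpecial {w : List A}
    (hfin : (factors z n).Finite) (hw : IsRightSpecial z w) (hwn : w.length = n)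
    (hns : ∀ t < factorComplexity z n, ¬ IsRightSpecial z (window z (x + t) n)) :
    IsEventuallyPeriodic z := by
  have hmem : w ∈ factors z n := mem_factors_iff.2 ⟨hw.isFactor, hwn⟩
  have hcard : (factors z n \ {w}).ncard <
      (Finset.range (factorComplexity z n) : Set ℕ).ncard := by
    rw [Set.ncard_coe_finset, Finset.card_range]
    exact Set.ncard_sdiff_singleton_lt_of_mem hmem hfin
  obtain ⟨s, hs, t, ht, hst, heq⟩ := Set.exists_ne_map_eq_of_ncard_lt_of_maps_to hcard
    (f := fun t => window z (x + t) n)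
    (fun t ht => ⟨⟨_, rfl⟩, fun h => hns t (by simpa using ht) (h ▸ hw)⟩) hfin.sdiff
  simp only [Finset.coe_range, Set.mem_Iio] at hs ht heq
  wlog hlt : s < t generalizing s t
  · exact this t s hst.symm heq.symm ht hs (by omega)
  refine isEventuallyPeriodic_of_window_eq (x := x + s) (p := t - s) (n := n) (by omega) ?_ ?_
  · rw [heq, Nat.add_assoc, Nat.add_sub_cancel' hlt.le]
  · intro r hr
    rw [Nat.add_assoc]
    exact hns (s + r) (by omega)

end EventuallyPeriodic

section Palindrome

variable {z : ℕ → A} {s : List A} {a b : A}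

lemma eq_of_suffix_of_prefix_of_palindrome (hs : s.Palindrome) {x : List A} (hx : x ≠ [])
    (hsuf : x <:+ a :: (s ++ [a])) (hpre : x <+: b :: s) : a = b := by
  have hrev : x.reverse <+: a :: (s ++ [a]) := by
    rw [← (hs.cons_concat a).reverse_eq]
    exact List.reverse_prefix.2 hsuf
  obtain ⟨c, y, rfl⟩ := List.exists_cons_of_ne_nil hx
  obtain ⟨rfl, hy⟩ := List.cons_prefix_cons.1 hpre
  rcases List.eq_nil_or_concat y with rfl | ⟨y, d, rfl⟩
  · simpa [eq_comm] using hrev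
  · simp only [List.concat_eq_append, List.reverse_cons, List.reverse_append, List.reverse_nil,
      List.nil_append, List.cons_append, List.cons_prefix_cons] at hrev hy
    obtain ⟨rfl, hrev⟩ := hrev
    have heq : y ++ [d] = y.reverse ++ [c] :=
      (List.prefix_of_prefix_length_le (hy.trans (List.prefix_append s [d])) hrev
        (by simp)).eq_of_length (by simp)
    simpa using (List.append_inj' heq rfl).2

/-- Among the `|s| + 2` positions inside the occurrence of `a s a`, none is one of `b s`, and there
are at most `|s| + 1` other factors of that length. -/
lemma isEventuallyPeriodic_of_palindrome (hfin : (factors z (s.length + 1)).Finite)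
    (hcard : factorComplexity z (s.length + 1) ≤ s.length + 2) (hab : a ≠ b) (hs : s.Palindrome)
    (ha : IsFactor z (a :: (s ++ [a]))) (hb : IsRightSpecial z (b :: s))
    (huniq : ∀ w, IsRightSpecial z w → w.length = s.length + 1 → w = b :: s) :
    IsEventuallyPeriodic z := by
  obtain ⟨i, hi⟩ := ha
  simp only [List.length_cons, List.length_append, List.length_nil, zero_add] at hi
  refine isEventuallyPeriodic_of_forall_not_isRightSpecial hfin hb rfl (x := i) fun t ht hrs => ?_
  have hbs : window z (i + t) (s.length + 1) = b :: s := huniq _ hrs (length_window _ _ _)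
  rcases Nat.eq_zero_or_pos t with rfl | hpos
  · rw [window_succ'] at hi hbs
    exact hab ((List.cons.inj hi).1.symm.trans (List.cons.inj hbs).1)
  refine hab (eq_of_suffix_of_prefix_of_palindrome hs
    (x := window z (i + t) (s.length + 2 - t)) ?_ ?_ ?_)
  · rw [← List.length_pos_iff, length_window]
    omega
  · have hlen : t + (s.length + 2 - t) = s.length + 1 + 1 := by omega
    have hcut : window z i t ++ window z (i + t) (s.length + 2 - t) = a :: (s ++ [a]) := by
      rw [← window_add, hlen, hi]
    rw [← hcut]
    exact List.suffix_append _ _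
  · have hlen : s.length + 2 - t + (t - 1) = s.length + 1 := by omega
    rw [← hbs, ← hlen, window_add]
    exact List.prefix_append _ _

end Palindrome

section Balance

variable [DecidableEq A] {z : ℕ → A} {a b : A} {m : ℕ}

lemma eq_of_count_take_eq {u v : List A} (hlen : u.length = v.length)
    (hu : ∀ c ∈ u, c ∈ ({a, b} : Set A)) (hv : ∀ c ∈ v, c ∈ ({a, b} : Set A))
    (h : ∀ l ≤ u.length, (u.take l).count a = (v.take l).count a) : u = v := by
  induction u generalizing v with
  | nil => exact (List.length_eq_zero_iff.1 hlen.symm).symm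
  | cons c u ih =>
    obtain ⟨d, v, rfl⟩ := List.exists_cons_of_length_eq_add_one hlen.symm
    simp only [List.mem_cons, forall_eq_or_imp] at hu hv
    have hcd : c = d := by
      have h1 := h 1 (by simp)
      simp only [List.take_succ_cons, List.take_zero, List.count_singleton, beq_iff_eq] at h1
      rcases hu.1 with rfl | rfl <;> rcases hv.1 with rfl | rfl <;> simp_all
    subst hcd
    rw [ih (by simpa using hlen) hu.2 hv.2 fun l hl => ?_]
    simpa [List.count_cons] using h (l + 1) (by simpa using hl)

/-- `z` is balanced at length `m` for the letter `a`: the numbers of `a` in two factors of length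
`m` differ by at most one. -/
def BalancedAt (z : ℕ → A) (a : A) (m : ℕ) : Prop :=
  ∀ u ∈ factors z m, ∀ v ∈ factors z m, u.count a ≤ v.count a + 1

lemma count_eq_add_one_of_append_not_balanced {p p' q q' : List A}
    (hlt : ∀ l < p.length + p'.length, BalancedAt z a l) (hu : IsFactor z (p ++ p'))
    (hv : IsFactor z (q ++ q')) (hexcess : (q ++ q').count a + 1 < (p ++ p').count a)
    (hlen : p.length = q.length) (hlen' : p'.length = q'.length) (hp : p ≠ []) (hp' : p' ≠ []) :
    p.count a = q.count a + 1 ∧ p'.count a = q'.count a + 1 := by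
  rw [← List.length_pos_iff] at hp hp'
  have hpq : p.count a ≤ q.count a + 1 := hlt p.length (by omega)
    p (mem_factors_iff.2 ⟨hu.of_infix (List.prefix_append p p').isInfix, rfl⟩)
    q (mem_factors_iff.2 ⟨hv.of_infix (List.prefix_append q q').isInfix, hlen.symm⟩)
  have hpq' : p'.count a ≤ q'.count a + 1 := hlt p'.length (by omega)
    p' (mem_factors_iff.2 ⟨hu.of_infix (List.suffix_append p p').isInfix, rfl⟩)
    q' (mem_factors_iff.2 ⟨hv.of_infix (List.suffix_append q q').isInfix, hlen'.symm⟩)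
  rw [List.count_append, List.count_append] at hexcess
  omega

lemma ends_eq_and_middle_eq_of_not_balanced (hz : Set.range z ⊆ {a, b}) {s t : List A}
    {c d c' d' : A} (hlt : ∀ l < s.length + 2, BalancedAt z a l)
    (hu : IsFactor z (c :: (s ++ [d]))) (hv : IsFactor z (c' :: (t ++ [d'])))
    (hlen : s.length = t.length)
    (hexcess : (c' :: (t ++ [d'])).count a + 1 < (c :: (s ++ [d])).count a) :
    (c = a ∧ d = a) ∧ (c' = b ∧ d' = b) ∧ s = t := by
  have hcut (r : ℕ) (hr : r ≤ s.length) :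
      (c :: s.take r).count a = (c' :: t.take r).count a + 1 ∧
        (s.drop r ++ [d]).count a = (t.drop r ++ [d']).count a + 1 := by
    have happend (e f : A) (w : List A) :
        (e :: w.take r) ++ (w.drop r ++ [f]) = e :: (w ++ [f]) := by
      rw [List.cons_append, ← List.append_assoc, List.take_append_drop]
    refine count_eq_add_one_of_append_not_balanced (z := z) (fun l hl => hlt l ?_) ?_ ?_ ?_
      (by simp [hlen]) (by simp [hlen]) (by simp) (by simp)
    · simp only [List.length_cons, List.length_append, List.length_take, List.length_drop,
        List.length_nil] at hl
      omega
    all_goals simpa only [happend]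
  have hends (e f : A) (h : [e].count a = [f].count a + 1) : e = a ∧ f ≠ a := by
    simp only [List.count_singleton, beq_iff_eq] at h
    grind
  obtain ⟨rfl, hc'⟩ := hends c c' (by simpa using (hcut 0 (Nat.zero_le _)).1)
  obtain ⟨rfl, hd'⟩ := hends d d' (by
    have hlast := (hcut s.length le_rfl).2
    rwa [List.drop_length, hlen, List.drop_length] at hlast)
  refine ⟨⟨rfl, rfl⟩, ⟨(hz (hv.mem_range (by simp))).resolve_left hc',
    (hz (hv.mem_range (by simp))).resolve_left hd'⟩, ?_⟩
  refine eq_of_count_take_eq hlen (fun e he => hz (hu.mem_range (by simp [he])))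
    (fun e he => hz (hv.mem_range (by simp [he]))) fun r hr => ?_
  have := (hcut r hr).1
  rwa [List.count_cons_self, List.count_cons_of_ne hc', Nat.add_right_cancel_iff] at this

lemma exists_isFactor_of_not_balancedAt (hz : Set.range z ⊆ {a, b})
    (hlt : ∀ l < m, BalancedAt z a l) (hm : ¬ BalancedAt z a m) :
    ∃ s, s.length + 2 = m ∧ IsFactor z (a :: (s ++ [a])) ∧ IsFactor z (b :: (s ++ [b])) := by
  simp only [BalancedAt, not_forall, not_le, mem_factors_iff] at hm
  obtain ⟨u, ⟨hu, rfl⟩, v, ⟨hv, hvu⟩, hexcess⟩ := hm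
  have hsplit (w : List A) (hw : 2 ≤ w.length) : ∃ c s d, w = c :: (s ++ [d]) := by
    obtain ⟨c, w, rfl⟩ := List.exists_cons_of_length_pos (by omega : 0 < w.length)
    obtain ⟨s, d, rfl⟩ := (List.eq_nil_or_concat w).resolve_left (by rintro rfl; simp at hw)
    exact ⟨c, s, d, by simp⟩
  have hlen : 2 ≤ u.length := by
    have := u.count_le_length (a := a)
    omega
  obtain ⟨c, s, d, rfl⟩ := hsplit u hlen
  obtain ⟨c', t, d', rfl⟩ := hsplit v (by omega)
  obtain ⟨⟨rfl, rfl⟩, ⟨rfl, rfl⟩, rfl⟩ := ends_eq_and_middle_eq_of_not_balanced hz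
    (fun l hl => hlt l (by simp; omega)) hu hv (by simpa using hvu.symm) hexcess
  exact ⟨s, by simp, hu, hv⟩

lemma palindrome_of_balancedAt (hz : Set.range z ⊆ {a, b}) (hab : a ≠ b) {s : List A}
    (hbal : ∀ l < s.length + 2, BalancedAt z a l) (ha : IsFactor z (a :: (s ++ [a])))
    (hb : IsFactor z (b :: (s ++ [b]))) : s.Palindrome := by
  have hletter : ∀ c ∈ s, c ∈ ({a, b} : Set A) := fun c hc => hz (ha.mem_range (by simp [hc]))
  refine .of_reverse_eq (eq_of_count_take_eq (a := a) (b := b) (by simp) (by simpa using hletter)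
    hletter fun r hr => ?_)
  rw [List.length_reverse] at hr
  rw [List.take_reverse, List.count_reverse]
  have hmem : ∀ c, IsFactor z (c :: (s ++ [c])) → c :: s.take r ∈ factors z (r + 1) ∧
      s.drop (s.length - r) ++ [c] ∈ factors z (r + 1) := by
    intro c hc
    simp only [mem_factors_iff, List.length_cons, List.length_append, List.length_take,
      List.length_drop, List.length_nil]
    refine ⟨⟨hc.of_infix ⟨[], s.drop r ++ [c], by simp [← List.append_assoc]⟩, by omega⟩,
      hc.of_infix ⟨c :: s.take (s.length - r), [], ?_⟩, by omega⟩
    simp [← List.append_assoc]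
  have hle := hbal (r + 1) (by omega) _ (hmem a ha).1 _ (hmem b hb).2
  have hge := hbal (r + 1) (by omega) _ (hmem a ha).2 _ (hmem b hb).1
  rw [List.count_append, List.count_singleton_self, List.count_cons_of_ne hab.symm] at hge
  rw [List.count_append, List.count_cons_self, List.count_singleton,
    if_neg (by simpa using hab.symm)] at hle
  omega

theorem balancedAt_of_factorComplexity_eq (hz : Set.range z ⊆ {a, b}) (hab : a ≠ b)
    (hper : ¬ IsEventuallyPeriodic z) (hm : ∀ l ≤ m, factorComplexity z l = l + 1) :
    BalancedAt z a m := by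
  induction m using Nat.strong_induction_on with
  | _ m ih =>
    by_contra hun
    have hbal : ∀ l < m, BalancedAt z a l := fun l hl => ih l hl fun r hr => hm r (by omega)
    obtain ⟨s, rfl, ha, hb⟩ := exists_isFactor_of_not_balancedAt hz hbal hun
    have hpal : s.Palindrome := palindrome_of_balancedAt hz hab hbal ha hb
    have hfin : (Set.range z).Finite := (Set.toFinite _).subset hz
    have hgrow : ∀ l ≤ s.length + 1, factorComplexity z (l + 1) = factorComplexity z l + 1 :=
      fun l hl => by rw [hm l (by omega), hm (l + 1) (by omega)]
    have hs : IsRightSpecial z s :=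
      ⟨a, b, hab, ha.of_infix ⟨[a], [], by simp⟩, hb.of_infix ⟨[b], [], by simp⟩⟩
    obtain ⟨w, hw, hwlen⟩ := exists_isRightSpecial hfin (n := s.length + 1)
      ((Nat.lt_succ_self _).trans_eq (hgrow _ le_rfl).symm)
    obtain ⟨c, t, rfl⟩ := List.exists_cons_of_length_eq_add_one hwlen
    obtain rfl : t = s := (hw.of_suffix (List.suffix_cons c t)).eq_of_length_eq hfin
      (hgrow _ (by omega)).le hs (by simpa using hwlen) rfl
    have huniq : ∀ w, IsRightSpecial z w → w.length = t.length + 1 → w = c :: t :=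
      fun w hw' hlen => hw'.eq_of_length_eq hfin (hgrow _ le_rfl).le hw hlen hwlen
    have hcard := (hm (t.length + 1) (by omega)).le
    rcases hz (hw.isFactor.mem_range List.mem_cons_self) with rfl | rfl
    · exact hper (isEventuallyPeriodic_of_palindrome (finite_factors hfin _) hcard hab.symm hpal hb
        hw huniq)
    · exact hper (isEventuallyPeriodic_of_palindrome (finite_factors hfin _) hcard hab hpal ha
        hw huniq)

end Balance

section Separation

variable [DecidableEq A] {z : ℕ → A} {a b : A} {k n : ℕ} {u v : List A}

lemma eq_zero_of_sum_eq_zero_of_sub_le_one {ι : Type*} {s : Finset ι} {f : ι → ℤ}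
    (hf : ∀ i ∈ s, ∀ j ∈ s, f i - f j ≤ 1) (hsum : ∑ i ∈ s, f i = 0) : ∀ i ∈ s, f i = 0 := by
  by_cases hneg : ∃ j ∈ s, f j < 0
  · obtain ⟨j, hj, hj'⟩ := hneg
    refine (Finset.sum_eq_zero_iff_of_nonpos fun i hi => ?_).1 hsum
    have := hf i hi j hj
    omega
  · push Not at hneg
    exact (Finset.sum_eq_zero_iff_of_nonneg hneg).1 hsum

lemma sub_count_take_sub_le_one (hbal : ∀ l < n, BalancedAt z a l) (hu : u ∈ factors z n)
    (hv : v ∈ factors z n) {i j : ℕ} (hi : i < n) (hj : j < n) :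
    ((u.take i).count a - (v.take i).count a : ℤ) -
      ((u.take j).count a - (v.take j).count a) ≤ 1 := by
  have hblock : ∀ w ∈ factors z n, ∀ i j, i ≤ j → j < n →
      ∃ x ∈ factors z (j - i), (w.take j).count a = (w.take i).count a + x.count a := by
    intro w hw i j hij hj
    obtain ⟨hw', rfl⟩ := mem_factors_iff.1 hw
    refine ⟨(w.take j).drop i, mem_factors_iff.2 ⟨hw'.of_infix ?_, ?_⟩, ?_⟩
    · exact (List.drop_suffix i _).isInfix.trans (List.take_prefix j w).isInfix
    · rw [List.length_drop, List.length_take, min_eq_left hj.le]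
    · rw [← List.count_append, ← Nat.min_eq_left hij, ← List.take_take, Nat.min_eq_left hij,
        List.take_append_drop]
  rcases le_total i j with hij | hji
  · obtain ⟨x, hx, hxu⟩ := hblock u hu i j hij hj
    obtain ⟨y, hy, hyv⟩ := hblock v hv i j hij hj
    have := hbal (j - i) (by omega) y hy x hx
    omega
  · obtain ⟨x, hx, hxu⟩ := hblock u hu j i hji hi
    obtain ⟨y, hy, hyv⟩ := hblock v hv j i hji hi
    have := hbal (i - j) (by omega) x hx y hy
    omega

theorem eq_of_binomEquiv_of_balancedAt (hz : Set.range z ⊆ {a, b})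
    (hbal : ∀ l < n, BalancedAt z a l) (hk : 2 ≤ k) (hu : u ∈ factors z n) (hv : v ∈ factors z n)
    (h : binomEquiv A k u v) : u = v := by
  have hperm : u.Perm v := perm_of_binomEquiv (by omega) h
  obtain ⟨hu', rfl⟩ := mem_factors_iff.1 hu
  obtain ⟨hv', -⟩ := mem_factors_iff.1 hv
  have hsum : ∑ l ∈ Finset.range u.length, ((u.take l).count a - (v.take l).count a : ℤ) = 0 := by
    have := sum_count_take_eq_of_binomEquiv hk h a
    rw [← hperm.length_eq] at this
    rw [Finset.sum_sub_distrib, sub_eq_zero]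
    exact_mod_cast this
  have hzero := eq_zero_of_sum_eq_zero_of_sub_le_one (fun i hi j hj =>
    sub_count_take_sub_le_one hbal hu hv (Finset.mem_range.1 hi) (Finset.mem_range.1 hj)) hsum
  refine eq_of_count_take_eq hperm.length_eq (fun c hc => hz (hu'.mem_range hc))
    (fun c hc => hz (hv'.mem_range hc)) fun l hl => ?_
  rcases hl.lt_or_eq with hl | rfl
  · exact_mod_cast sub_eq_zero.1 (hzero l (Finset.mem_range.2 hl))
  · rw [List.take_length, hperm.length_eq, List.take_length, hperm.count_eq]

end Separation

section Complexity

variable [DecidableEq A] {z : ℕ → A} {k n : ℕ}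

lemma binomComplexity_le_factorComplexity (hz : (Set.range z).Finite) (k n : ℕ) :
    binomComplexity k z n ≤ factorComplexity z n :=
  have : Finite (factors z n) := finite_factors hz n
  Nat.card_le_card_of_surjective _ Quotient.mk_surjective

lemma binomComplexity_eq_factorComplexity
    (h : ∀ u ∈ factors z n, ∀ v ∈ factors z n, binomEquiv A k u v → u = v) :
    binomComplexity k z n = factorComplexity z n := by
  refine (Nat.card_congr (Equiv.ofBijective (Quotient.mk _) ⟨?_, Quotient.mk_surjective⟩)).symm
  exact fun u v huv => Subtype.ext (h u u.2 v v.2 (Quotient.exact (b := v) huv))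

lemma binomComplexity_eq_factorComplexity_of_le_one (hk : 1 ≤ k) (hn : n ≤ 1) :
    binomComplexity k z n = factorComplexity z n := by
  refine binomComplexity_eq_factorComplexity fun u hu v hv h => ?_
  have hperm : u.Perm v := perm_of_binomEquiv hk h
  obtain ⟨i, rfl⟩ := hu
  obtain ⟨j, rfl⟩ := hv
  interval_cases n
  · rfl
  · simpa [window] using hperm

theorem binomComplexity_eq_factorComplexity_of_forall_lt (hk : 2 ≤ k)
    (hper : ¬ IsEventuallyPeriodic z) (hn : ∀ m < n, factorComplexity z m = m + 1) :
    binomComplexity k z n = factorComplexity z n := by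
  rcases Nat.lt_or_ge 1 n with hlt | hle
  · obtain ⟨a, b, hab, hz⟩ := exists_range_subset_pair (hn 1 hlt)
    have hbal : ∀ l < n, BalancedAt z a l := fun l hl =>
      balancedAt_of_factorComplexity_eq hz hab hper fun r hr => hn r (by omega)
    exact binomComplexity_eq_factorComplexity fun u hu v hv =>
      eq_of_binomEquiv_of_balancedAt hz hbal hk hu hv
  · exact binomComplexity_eq_factorComplexity_of_le_one (by omega) hle

end Complexity

end InfWord

open InfWord in
theorem mainTheorem2_general {A : Type*} [DecidableEq A] (z : ℕ → A) (k : ℕ) (hk : 2 ≤ k) :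
    (∀ n : ℕ, binomComplexity k z n = n + 1) ↔ IsSturmian z := by
  constructor
  · intro h
    have hone : factorComplexity z 1 = 2 := by
      rw [← binomComplexity_eq_factorComplexity_of_le_one (by omega : 1 ≤ k) le_rfl, h]
    obtain ⟨a, b, -, hz⟩ := exists_range_subset_pair hone
    have hper : ¬ IsEventuallyPeriodic z := not_isEventuallyPeriodic_of_lt_factorComplexity fun n =>
      (h n).ge.trans (binomComplexity_le_factorComplexity ((Set.toFinite _).subset hz) k n)
    intro n
    induction n using Nat.strong_induction_on with
    | _ n ih => rw [← binomComplexity_eq_factorComplexity_of_forall_lt hk hper ih, h n]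
  · intro h n
    have hper : ¬ IsEventuallyPeriodic z :=
      not_isEventuallyPeriodic_of_lt_factorComplexity fun m => (h m).ge
    rw [binomComplexity_eq_factorComplexity_of_forall_lt hk hper fun m _ => h m, h n]

theorem mainTheorem2 {A : Type*} [Finite A] [DecidableEq A] (z : ℕ → A) (k : ℕ) (hk : 2 ≤ k) :
    (∀ n : ℕ, InfWord.binomComplexity k z n = n + 1) ↔ InfWord.IsSturmian z :=
  mainTheorem2_general z k hk
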